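/- Two nodes share a fixed total of $U\ge 1$ energy units. At each channel use Node 1 and Node 2 simultaneously send binary symbols $X_1,X_2\in\{0,1\}$; each is received without noise by the other node. Sending a $1$ moves one energy unit from the sender to the other node, sending a $0$ is free, and a node without energy can only send $0$. Thus, if Node 1 has $U_{1,k}$ units at channel use $k$ (and Node 2 has $U-U_{1,k}$), then $U_{1,k+1}=U_{1,k}-X_{1,k}+X_{2,k}$; the initial value $U_{1,1}=u_{1,1}\in\{0,\dots,U\}$ is known to both nodes. An $(n,R_1,R_2,U)$ code, with $R_1,R_2\ge 0$, consists of encoding functions, where Node $j$ chooses $X_{j,k}$, $1\le k\le n$, as a function of its message $M_j$ and of the symbols received before channel use $k$, always respecting the energy constraint, and of decoding functions, by which each node estimates the other node's message from its own message and its $n$ received symbols. Here $M_1,M_2$ are independent and $M_j$ is uniform on a set of $\lceil 2^{nR_j}\rceil$ messages. The pair $(R_1,R_2)$ is achievable if for every $\varepsilon>0$ there is for all sufficiently large $n$ an $(n,R_1,R_2,U)$ code for which the probability that at least one of the two estimates is wrong is at most $\varepsilon$. The capacity region $\mathcal C(U)$ is the closure of the set of achievable rate pairs. **Proposition.** Let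 $p_{1|0}=p_{2|0}=0$ and $0<p_{1|u},p_{2|u}<1$ for $u=1,\dots,U$. For $u=0,\dots,U$ let $$\phi_{0,0|u}=(1-p_{1|u})(1-p_{2|U-u}),\quad \phi_{0,1|u}=(1-p_{1|u})\,p_{2|U-u},\quad \phi_{1,0|u}=p_{1|u}(1-p_{2|U-u}),\quad \phi_{1,1|u}=p_{1|u}\,p_{2|U-u},$$ and let $\pi_0,\dots,\pi_U\ge 0$ with $\sum_{u=0}^{U}\pi_u=1$ be the stationary distribution of the associated birth–death chain of Node 1's energy, that is, $$\pi_u=\pi_u(\phi_{0,0|u}+\phi_{1,1|u})+\pi_{u-1}\phi_{0,1|u-1}+\pi_{u+1}\phi_{1,0|u+1},\qquad u=0,\dots,U,$$ where the terms with $\pi_{-1}$ and $\pi_{U+1}$ are zero. Then, for every initial state $u_{1,1}\in\{0,\dots,U\}$, every pair of rates $R_1,R_2\ge 0$ (in bits per channel use) with $$R_1\le\sum_{u=1}^{U}\pi_u\,H(p_{1|u}),\qquad R_2\le\sum_{u=1}^{U}\pi_{U-u}\,H(p_{2|u})$$ belongs to $\mathcal C(U)$, where $H(p)=-p\log_2 p-(1-p)\log_2(1-p)$.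 -/

import Mathlib

/-!
Binary noiseless two-way channel with energy exchange: a total of `U` energy units is shared by
two nodes, sending a one (`true`) moves one unit to the other node, sending a zero (`false`) is free.
Channel uses are numbered from `0`, so that channel use `k` is preceded by exactly `k` others.
-/

open Finset

noncomputable section

namespace TwoWay

/-- The encoding functions of the two nodes. Node `j` maps its message and the list of the past
received symbols (most recent first) to the symbol to send. The length of that list is the number
of past channel uses, so one function on lists holds the whole sequence of encoding functions. -/
structure Encoders (M₁ M₂ : ℕ) where
  f₁ : Fin M₁ → List Bool → Bool
  f₂ : Fin M₂ → List Bool → Bool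

namespace Encoders

variable {M₁ M₂ : ℕ} (e : Encoders M₁ M₂) (m₁ : Fin M₁) (m₂ : Fin M₂)

/-- The symbols sent by Node 1 and by Node 2 in the first `k` channel uses, most recent first.
The channel is noiseless: each node receives exactly what the other one sends. -/
def past : ℕ → List Bool × List Bool
  | 0 => ([], [])
  | k + 1 => (e.f₁ m₁ (past k).2 :: (past k).1, e.f₂ m₂ (past k).1 :: (past k).2)

/-- The symbol sent by Node 1 at channel use `k`. -/
def x₁ (k : ℕ) : Bool := e.f₁ m₁ (e.past m₁ m₂ k).2

/-- The symbol sent by Node 2 at channel use `k`. -/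
def x₂ (k : ℕ) : Bool := e.f₂ m₂ (e.past m₁ m₂ k).1

/-- The number of energy units at Node 1 at channel use `k`, starting from `u₀` units. -/
def energy (u₀ : ℕ) : ℕ → ℕ
  | 0 => u₀
  | k + 1 => energy u₀ k - (e.x₁ m₁ m₂ k).toNat + (e.x₂ m₁ m₂ k).toNat

end Encoders

/-- The number of messages of a node that communicates at rate `R` over `n` channel uses:
`2 ^ (n R)`, rounded up to an integer. -/
def numMessages (n : ℕ) (R : ℝ) : ℕ := ⌈(2 : ℝ) ^ ((n : ℝ) * R)⌉₊

/-- A code of block length `n` and rates `R₁`, `R₂`, for `U` energy units in total, of which `u₀`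
are at Node 1 initially. A node without energy can only send a zero, for all pairs of messages. -/
structure Code (U u₀ n : ℕ) (R₁ R₂ : ℝ) extends
    Encoders (numMessages n R₁) (numMessages n R₂) where
  /-- Node 1's estimate of Node 2's message, from its own message and the received symbols. -/
  g₁ : Fin (numMessages n R₁) → List Bool → Fin (numMessages n R₂)
  /-- Node 2's estimate of Node 1's message, from its own message and the received symbols. -/
  g₂ : Fin (numMessages n R₂) → List Bool → Fin (numMessages n R₁)
  alphabet₁ : ∀ m₁ m₂, ∀ k < n, toEncoders.x₁ m₁ m₂ k = true →
    1 ≤ toEncoders.energy m₁ m₂ u₀ k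
  alphabet₂ : ∀ m₁ m₂, ∀ k < n, toEncoders.x₂ m₁ m₂ k = true →
    1 ≤ U - toEncoders.energy m₁ m₂ u₀ k

open Classical in
/-- The probability that at least one of the two nodes decodes wrongly, when the two messages are
independent and uniformly distributed. -/
def Code.errorProb {U u₀ n : ℕ} {R₁ R₂ : ℝ} (c : Code U u₀ n R₁ R₂) : ℝ :=
  ((univ.filter fun m : Fin (numMessages n R₁) × Fin (numMessages n R₂) =>
      c.g₁ m.1 (c.past m.1 m.2 n).2 ≠ m.2 ∨ c.g₂ m.2 (c.past m.1 m.2 n).1 ≠ m.1).card : ℝ) /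
    ((numMessages n R₁ : ℝ) * (numMessages n R₂ : ℝ))

/-- The rate pair `(R₁, R₂)` is achievable: for all sufficiently large `n` there are codes with
arbitrarily small probability of error. -/
def Achievable (U u₀ : ℕ) (R₁ R₂ : ℝ) : Prop :=
  0 ≤ R₁ ∧ 0 ≤ R₂ ∧ ∀ ε : ℝ, 0 < ε → ∃ N : ℕ, ∀ n : ℕ, N ≤ n →
    ∃ c : Code U u₀ n R₁ R₂, c.errorProb ≤ ε

/-- The capacity region: the closure of the set of achievable rate pairs. -/
def capacityRegion (U u₀ : ℕ) : Set (ℝ × ℝ) :=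
  closure {R : ℝ × ℝ | Achievable U u₀ R.1 R.2}

/-- The entropy, in bits, of a Bernoulli variable of parameter `p`. -/
def bernEntropy (p : ℝ) : ℝ := Real.binEntropy p / Real.log 2

/-- The probability that a Bernoulli variable of parameter `p` takes the value `x`. -/
def bern (p : ℝ) (x : Bool) : ℝ := if x then p else 1 - p

/-- The probability that Node 1 sends `a` and Node 2 sends `b` when Node 1 has `u` energy units and
Node 2 has `U - u`, where a node `j` with `v` units sends a one with probability `p_j v`, the two
nodes independently of each other. -/
def phi (U : ℕ) (p₁ p₂ : ℕ → ℝ) (a b : Bool) (u : ℕ) : ℝ := bern (p₁ u) a * bern (p₂ (U - u)) b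

/-- `π` is a stationary distribution, on the states `0, …, U`, of the birth-death chain of Node 1's
energy: the energy drops by one when only Node 1 sends a one, and grows by one when only Node 2
does. -/
structure IsStationary (U : ℕ) (p₁ p₂ : ℕ → ℝ) (π : ℕ → ℝ) : Prop where
  nonneg : ∀ u ≤ U, 0 ≤ π u
  sum_eq_one : ∑ u ∈ Icc 0 U, π u = 1
  fixed_point : ∀ u ≤ U,
    π u = π u * (phi U p₁ p₂ false false u + phi U p₁ p₂ true true u)
      + (if u = 0 then 0 else π (u - 1) * phi U p₁ p₂ false true (u - 1))
      + (if u = U then 0 else π (u + 1) * phi U p₁ p₂ true false (u + 1))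

end TwoWay

end

/-!
The proof is by random coding over strategies that depend on the energy state only. A codeword of a
node prescribes, for each channel use and each energy state of the node, the symbol to be sent; its
entries are independent, and a one has probability `pⱼ v` in state `v`. Since the channel is
noiseless and the total energy is fixed, both nodes know the energy state at all times, and under
random codewords the state is exactly the birth–death chain of the theorem (`sum_weight_mul_send`).

Node 2 errs only if another codeword of Node 1 prescribes the very symbols that were sent, along the
path of states that was taken. For an independent codeword this has probability
`∏ₖ bern (p₁ (uₖ)) (xₖ)` (`sum_wordWeight_consistent`), whose negative logarithm is the sum along the
path of a function with stationary mean `∑ᵤ πᵤ H(p₁ᵤ)`. Hence a union bound over the messages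
(`exists_codebooks`) suffices, once that sum is known to be near its mean.

That law of large numbers comes from the Poisson equation of the chain, which can be solved state by
state thanks to detailed balance (`IsStationary.exists_poisson`): corrected by the solution, the sum
is a martingale with bounded increments, so its second moment grows linearly (`second_moment_le`)
and Chebyshev's inequality applies. The error probability is then of order `1 / n` for every pair
of rates strictly below the two bounds, and the boundary is reached by taking the closure.
-/

namespace TwoWay

/-! ### Product weights on a finite function space -/

section ProductWeights

variable {ι : Type*} [Fintype ι] [DecidableEq ι] {W : Type*} [Fintype W]

/-- Under a product weight, one coordinate may be replaced by an independent copy of itself. -/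
theorem sum_prod_mul_eq_resample (P : ι → W → ℝ) (hP : ∀ i, ∑ x, P i x = 1) (a : ι)
    (F : (ι → W) → ℝ) :
    ∑ c : ι → W, (∏ i, P i (c i)) * F c
      = ∑ c : ι → W, (∏ i, P i (c i)) * ∑ x, P a x * F (Function.update c a x) := by
  have key : ∀ G : (ι → W) → ℝ, ∑ c : ι → W, (∏ i, P i (c i)) * G c
      = ∑ d : {j // j ≠ a} → W, (∏ j : {j // j ≠ a}, P j (d j)) *
        ∑ x, P a x * G ((Equiv.funSplitAt a W).symm (x, d)) := by
    intro G
    rw [← (Equiv.funSplitAt a W).symm.sum_comp, Fintype.sum_prod_type_right]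
    refine sum_congr rfl fun d _ => ?_
    rw [mul_sum]
    refine sum_congr rfl fun x _ => ?_
    rw [← mul_assoc]
    congr 1
    rw [Fintype.prod_eq_mul_prod_subtype_ne _ a, mul_comm]
    congr 1
    · refine prod_congr rfl fun j _ => ?_
      simp [Equiv.funSplitAt, Equiv.piSplitAt, j.2]
    · simp [Equiv.funSplitAt, Equiv.piSplitAt]
  have upd : ∀ (x y : W) (d : {j // j ≠ a} → W),
      Function.update ((Equiv.funSplitAt a W).symm (y, d)) a x
        = (Equiv.funSplitAt a W).symm (x, d) := by
    intro x y d
    ext j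
    by_cases h : j = a
    · subst h; simp [Equiv.funSplitAt, Equiv.piSplitAt]
    · simp [Equiv.funSplitAt, Equiv.piSplitAt, h]
  rw [key, key]
  refine sum_congr rfl fun d _ => ?_
  simp only [upd]
  rw [← sum_mul, hP a, one_mul]

theorem sum_prod_eq_one (P : ι → W → ℝ) (hP : ∀ i, ∑ x, P i x = 1) :
    ∑ c : ι → W, ∏ i, P i (c i) = 1 := by
  classical
  rw [← Fintype.piFinset_univ, sum_prod_piFinset]
  exact prod_eq_one fun i _ => hP i

theorem sum_prod_mul_eval (P : ι → W → ℝ) (hP : ∀ i, ∑ x, P i x = 1) (a : ι) (G : W → ℝ) :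
    ∑ c : ι → W, (∏ i, P i (c i)) * G (c a) = ∑ x, P a x * G x := by
  rw [sum_prod_mul_eq_resample P hP a]
  simp only [Function.update_self]
  rw [← sum_mul, sum_prod_eq_one P hP, one_mul]

theorem sum_prod_mul_eval_pair (P : ι → W → ℝ) (hP : ∀ i, ∑ x, P i x = 1) {a b : ι}
    (hab : a ≠ b) (G : W → W → ℝ) :
    ∑ c : ι → W, (∏ i, P i (c i)) * G (c a) (c b) = ∑ x, P a x * ∑ y, P b y * G x y := by
  rw [sum_prod_mul_eq_resample P hP b]
  simp only [Function.update_self, Function.update_of_ne hab]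
  exact sum_prod_mul_eval P hP a fun x => ∑ y, P b y * G x y

end ProductWeights

/-- Some value of a function is at most its weighted average. -/
theorem exists_le_of_weighted_sum_le {Ω : Type*} [Fintype Ω] (P F : Ω → ℝ) (h0 : ∀ x, 0 ≤ P x)
    (h1 : ∑ x, P x = 1) {E : ℝ} (hE : ∑ x, P x * F x ≤ E) : ∃ x, F x ≤ E := by
  by_contra! hcon
  have hsum : ∑ x, P x * (F x - E) ≤ 0 := by
    simp only [mul_sub, sum_sub_distrib, ← sum_mul, h1]; linarith
  have hnn : ∀ x ∈ univ, 0 ≤ P x * (F x - E) :=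
    fun x _ => mul_nonneg (h0 x) (by linarith [hcon x])
  have hz := (sum_eq_zero_iff_of_nonneg hnn).1 (le_antisymm hsum (sum_nonneg hnn))
  have : ∑ x, P x = 0 := sum_eq_zero fun x hx =>
    (mul_eq_zero.1 (hz x hx)).resolve_right (by linarith [hcon x])
  linarith

/-! ### Random coding -/

open Classical in
/-- Random coding for two users. The codewords of user `j` are drawn independently with weight
`Pⱼ`; `K₁ y x x'` says that user 2, whose own codeword is `y`, may take `x'` for the codeword `x`
of user 1, and `K₂ x y y'` is the same with the users exchanged. If, for pairs of codewords in `T`,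
an independent codeword is confusable with weight at most `qⱼ`, then some pair of codebooks has
average error at most the weight of the complement of `T` plus `M₁ q₁ + M₂ q₂`. -/
theorem exists_codebooks {W₁ W₂ : Type*} [Fintype W₁] [Fintype W₂]
    (P₁ : W₁ → ℝ) (P₂ : W₂ → ℝ) (hP₁ : ∀ x, 0 ≤ P₁ x) (hP₂ : ∀ y, 0 ≤ P₂ y)
    (hs₁ : ∑ x, P₁ x = 1) (hs₂ : ∑ y, P₂ y = 1)
    (T : W₁ → W₂ → Prop) (K₁ : W₂ → W₁ → W₁ → Prop) (K₂ : W₁ → W₂ → W₂ → Prop)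
    {q₁ q₂ : ℝ} (hq₁ : 0 ≤ q₁) (hq₂ : 0 ≤ q₂)
    (h₁ : ∀ x y, T x y → ∑ x', P₁ x' * (if K₁ y x x' then 1 else 0) ≤ q₁)
    (h₂ : ∀ x y, T x y → ∑ y', P₂ y' * (if K₂ x y y' then 1 else 0) ≤ q₂)
    (M₁ M₂ : ℕ) :
    ∃ (c₁ : Fin M₁ → W₁) (c₂ : Fin M₂ → W₂),
      ((univ.filter fun m : Fin M₁ × Fin M₂ =>
        (∃ m', m' ≠ m.1 ∧ K₁ (c₂ m.2) (c₁ m.1) (c₁ m')) ∨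
        (∃ m', m' ≠ m.2 ∧ K₂ (c₁ m.1) (c₂ m.2) (c₂ m'))).card : ℝ)
      ≤ (M₁ * M₂ : ℝ) * (∑ x, P₁ x * ∑ y, P₂ y * (if T x y then 0 else 1)
          + M₁ * q₁ + M₂ * q₂) := by
  set τ : ℝ := ∑ x, P₁ x * ∑ y, P₂ y * (if T x y then 0 else 1)
  -- the indicator of an error is bounded by the indicators of finitely many simpler events
  let A : W₁ → W₂ → ℝ := fun x y => if T x y then 0 else 1
  let B₁ : W₂ → W₁ → W₁ → ℝ := fun y x x' => if T x y ∧ K₁ y x x' then 1 else 0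
  let B₂ : W₁ → W₂ → W₂ → ℝ := fun x y y' => if T x y ∧ K₂ x y y' then 1 else 0
  let G : (Fin M₁ → W₁) → (Fin M₂ → W₂) → ℝ := fun c₁ c₂ => ∑ m₁, ∑ m₂,
    (A (c₁ m₁) (c₂ m₂) + ∑ m' ∈ univ.erase m₁, B₁ (c₂ m₂) (c₁ m₁) (c₁ m')
      + ∑ m' ∈ univ.erase m₂, B₂ (c₁ m₁) (c₂ m₂) (c₂ m'))
  have hB₁0 : ∀ y x x', 0 ≤ B₁ y x x' := fun y x x' => by simp only [B₁]; split_ifs <;> norm_num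
  have hB₂0 : ∀ y x x', 0 ≤ B₂ y x x' := fun y x x' => by simp only [B₂]; split_ifs <;> norm_num
  have hA0 : ∀ x y, 0 ≤ A x y := fun x y => by simp only [A]; split_ifs <;> norm_num
  have hcard : ∀ (c₁ : Fin M₁ → W₁) (c₂ : Fin M₂ → W₂),
      ((univ.filter fun m : Fin M₁ × Fin M₂ =>
        (∃ m', m' ≠ m.1 ∧ K₁ (c₂ m.2) (c₁ m.1) (c₁ m')) ∨
        (∃ m', m' ≠ m.2 ∧ K₂ (c₁ m.1) (c₂ m.2) (c₂ m'))).card : ℝ) ≤ G c₁ c₂ := by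
    intro c₁ c₂
    rw [card_filter, Nat.cast_sum, Fintype.sum_prod_type]
    refine sum_le_sum fun m₁ _ => sum_le_sum fun m₂ _ => ?_
    have n₁ : ∀ m' ∈ univ.erase m₁, 0 ≤ B₁ (c₂ m₂) (c₁ m₁) (c₁ m') := fun _ _ => hB₁0 _ _ _
    have n₂ : ∀ m' ∈ univ.erase m₂, 0 ≤ B₂ (c₁ m₁) (c₂ m₂) (c₂ m') := fun _ _ => hB₂0 _ _ _
    have n₃ := hA0 (c₁ m₁) (c₂ m₂)
    by_cases hT : T (c₁ m₁) (c₂ m₂)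
    · split_ifs with herr
      · rcases herr with ⟨m', hne, hK⟩ | ⟨m', hne, hK⟩
        · have hle := single_le_sum n₁ (mem_erase.2 ⟨hne, mem_univ _⟩)
          have : B₁ (c₂ m₂) (c₁ m₁) (c₁ m') = 1 := if_pos ⟨hT, hK⟩
          have := sum_nonneg n₂
          push_cast; linarith
        · have hle := single_le_sum n₂ (mem_erase.2 ⟨hne, mem_univ _⟩)
          have : B₂ (c₁ m₁) (c₂ m₂) (c₂ m') = 1 := if_pos ⟨hT, hK⟩
          have := sum_nonneg n₁
          push_cast; linarith
      · have := sum_nonneg n₁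
        have := sum_nonneg n₂
        push_cast; linarith
    · have : A (c₁ m₁) (c₂ m₂) = 1 := if_neg hT
      have := sum_nonneg n₁
      have := sum_nonneg n₂
      split_ifs <;> push_cast <;> linarith
  let Q₁ : (Fin M₁ → W₁) → ℝ := fun c => ∏ m, P₁ (c m)
  let Q₂ : (Fin M₂ → W₂) → ℝ := fun c => ∏ m, P₂ (c m)
  have hQ₁ : ∑ c, Q₁ c = 1 := sum_prod_eq_one (fun _ => P₁) fun _ => hs₁
  have hQ₂ : ∑ c, Q₂ c = 1 := sum_prod_eq_one (fun _ => P₂) fun _ => hs₂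
  have ev₁ : ∀ m (f : W₁ → ℝ), ∑ c, Q₁ c * f (c m) = ∑ x, P₁ x * f x :=
    sum_prod_mul_eval (fun _ => P₁) fun _ => hs₁
  have ev₂ : ∀ m (f : W₂ → ℝ), ∑ c, Q₂ c * f (c m) = ∑ y, P₂ y * f y :=
    sum_prod_mul_eval (fun _ => P₂) fun _ => hs₂
  have evp₁ : ∀ m m', m ≠ m' → ∀ f : W₁ → W₁ → ℝ,
      ∑ c, Q₁ c * f (c m) (c m') = ∑ x, P₁ x * ∑ x', P₁ x' * f x x' := fun _ _ h f =>
    sum_prod_mul_eval_pair (fun _ => P₁) (fun _ => hs₁) h f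
  have evp₂ : ∀ m m', m ≠ m' → ∀ f : W₂ → W₂ → ℝ,
      ∑ c, Q₂ c * f (c m) (c m') = ∑ y, P₂ y * ∑ y', P₂ y' * f y y' := fun _ _ h f =>
    sum_prod_mul_eval_pair (fun _ => P₂) (fun _ => hs₂) h f
  -- expectations of the three kinds of terms
  have eA : ∀ m₁ m₂, ∑ c₁, Q₁ c₁ * ∑ c₂, Q₂ c₂ * A (c₁ m₁) (c₂ m₂) = τ := by
    intro m₁ m₂
    rw [sum_congr rfl fun c₁ _ => congrArg (Q₁ c₁ * ·) (ev₂ m₂ fun y => A (c₁ m₁) y)]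
    exact ev₁ m₁ fun x => ∑ y, P₂ y * A x y
  have avg₁ : ∀ f : W₁ → ℝ, ∀ r, (∀ x, f x ≤ r) → ∑ x, P₁ x * f x ≤ r := fun f r hf => by
    calc ∑ x, P₁ x * f x ≤ ∑ x, P₁ x * r := by gcongr with x; exacts [hP₁ x, hf x]
      _ = r := by rw [← sum_mul, hs₁, one_mul]
  have avg₂ : ∀ f : W₂ → ℝ, ∀ r, (∀ x, f x ≤ r) → ∑ x, P₂ x * f x ≤ r := fun f r hf => by
    calc ∑ x, P₂ x * f x ≤ ∑ x, P₂ x * r := by gcongr with x; exacts [hP₂ x, hf x]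
      _ = r := by rw [← sum_mul, hs₂, one_mul]
  have eB₁ : ∀ m₁ m₂, ∀ m' ∈ univ.erase m₁,
      ∑ c₁, Q₁ c₁ * ∑ c₂, Q₂ c₂ * B₁ (c₂ m₂) (c₁ m₁) (c₁ m') ≤ q₁ := by
    intro m₁ m₂ m' hm'
    have hne : m₁ ≠ m' := (ne_of_mem_erase hm').symm
    rw [sum_congr rfl fun c₁ _ => congrArg (Q₁ c₁ * ·)
      (ev₂ m₂ fun y => B₁ y (c₁ m₁) (c₁ m'))]
    refine (evp₁ m₁ m' hne fun x x' => ∑ y, P₂ y * B₁ y x x').trans_le ?_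
    refine avg₁ _ _ fun x => ?_
    have : ∑ x', P₁ x' * ∑ y, P₂ y * B₁ y x x' = ∑ y, P₂ y * ∑ x', P₁ x' * B₁ y x x' := by
      simp only [mul_sum]
      rw [sum_comm]
      exact sum_congr rfl fun _ _ => sum_congr rfl fun _ _ => by ring
    rw [this]
    refine avg₂ _ _ fun y => ?_
    by_cases hT : T x y
    · simpa [B₁, hT] using h₁ x y hT
    · simpa [B₁, hT] using hq₁
  have eB₂ : ∀ m₁ m₂, ∀ m' ∈ univ.erase m₂,
      ∑ c₁, Q₁ c₁ * ∑ c₂, Q₂ c₂ * B₂ (c₁ m₁) (c₂ m₂) (c₂ m') ≤ q₂ := by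
    intro m₁ m₂ m' hm'
    have hne : m₂ ≠ m' := (ne_of_mem_erase hm').symm
    rw [sum_congr rfl fun c₁ _ => congrArg (Q₁ c₁ * ·)
      (evp₂ m₂ m' hne fun y y' => B₂ (c₁ m₁) y y')]
    refine (ev₁ m₁ fun x => ∑ y, P₂ y * ∑ y', P₂ y' * B₂ x y y').trans_le ?_
    refine avg₁ _ _ fun x => avg₂ _ _ fun y => ?_
    by_cases hT : T x y
    · simpa [B₂, hT] using h₂ x y hT
    · simpa [B₂, hT] using hq₂
  have hE : ∑ c : (Fin M₁ → W₁) × (Fin M₂ → W₂), (Q₁ c.1 * Q₂ c.2) * G c.1 c.2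
      ≤ (M₁ * M₂ : ℝ) * (τ + M₁ * q₁ + M₂ * q₂) := by
    have hlin : ∑ c : (Fin M₁ → W₁) × (Fin M₂ → W₂), (Q₁ c.1 * Q₂ c.2) * G c.1 c.2
        = ∑ m₁, ∑ m₂, (∑ c₁, Q₁ c₁ * ∑ c₂, Q₂ c₂ * A (c₁ m₁) (c₂ m₂)
          + ∑ m' ∈ univ.erase m₁, ∑ c₁, Q₁ c₁ * ∑ c₂, Q₂ c₂ * B₁ (c₂ m₂) (c₁ m₁) (c₁ m')
          + ∑ m' ∈ univ.erase m₂, ∑ c₁, Q₁ c₁ * ∑ c₂, Q₂ c₂ * B₂ (c₁ m₁) (c₂ m₂) (c₂ m')) := by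
      have pull : ∀ {κ : Type} (s : Finset κ) (F : κ → (Fin M₁ → W₁) → (Fin M₂ → W₂) → ℝ),
          ∑ c₁, Q₁ c₁ * ∑ c₂, Q₂ c₂ * ∑ i ∈ s, F i c₁ c₂
            = ∑ i ∈ s, ∑ c₁, Q₁ c₁ * ∑ c₂, Q₂ c₂ * F i c₁ c₂ := by
        intro κ s F
        rw [sum_comm]
        refine sum_congr rfl fun c₁ _ => ?_
        rw [← mul_sum, sum_comm]
        congr 1
        refine sum_congr rfl fun c₂ _ => ?_
        rw [← mul_sum]
      rw [Fintype.sum_prod_type]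
      simp only [mul_assoc, ← mul_sum, G, pull, mul_add, sum_add_distrib]
    rw [hlin]
    have hM : (M₁ * M₂ : ℝ) * (τ + M₁ * q₁ + M₂ * q₂)
        = ∑ _m₁ : Fin M₁, ∑ _m₂ : Fin M₂, (τ + M₁ * q₁ + M₂ * q₂) := by
      simp; ring
    rw [hM]
    refine sum_le_sum fun m₁ _ => sum_le_sum fun m₂ _ => ?_
    have b₁ := sum_le_card_nsmul _ _ _ (eB₁ m₁ m₂)
    have b₂ := sum_le_card_nsmul _ _ _ (eB₂ m₁ m₂)
    have k₁ : (((univ : Finset (Fin M₁)).erase m₁).card : ℝ) ≤ M₁ := by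
      exact_mod_cast (card_le_univ _).trans (by simp)
    have k₂ : (((univ : Finset (Fin M₂)).erase m₂).card : ℝ) ≤ M₂ := by
      exact_mod_cast (card_le_univ _).trans (by simp)
    rw [nsmul_eq_mul] at b₁ b₂
    rw [eA]
    have := mul_le_mul_of_nonneg_right k₁ hq₁
    have := mul_le_mul_of_nonneg_right k₂ hq₂
    linarith
  obtain ⟨c, hc⟩ := exists_le_of_weighted_sum_le
    (fun c : (Fin M₁ → W₁) × (Fin M₂ → W₂) => Q₁ c.1 * Q₂ c.2) (fun c => G c.1 c.2)
    (fun c => mul_nonneg (prod_nonneg fun _ _ => hP₁ _) (prod_nonneg fun _ _ => hP₂ _))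
    (by rw [Fintype.sum_prod_type]; simp only [← mul_sum, hQ₁, hQ₂, mul_one]) hE
  exact ⟨c.1, c.2, (hcard _ _).trans hc⟩

/-! ### The birth–death chain of the energy -/

section Chain

variable {U : ℕ} {p₁ p₂ : ℕ → ℝ} {π : ℕ → ℝ}

theorem phi_stay_eq (u : ℕ) :
    phi U p₁ p₂ false false u + phi U p₁ p₂ true true u
      = 1 - phi U p₁ p₂ false true u - phi U p₁ p₂ true false u := by
  simp [phi, bern]; ring

theorem phi_false_true_pos (hp₁ : p₁ 0 = 0)
    (hp₁' : ∀ u ∈ Icc 1 U, 0 < p₁ u ∧ p₁ u < 1) (hp₂' : ∀ u ∈ Icc 1 U, 0 < p₂ u ∧ p₂ u < 1)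
    {u : ℕ} (hu : u < U) : 0 < phi U p₁ p₂ false true u := by
  have h2 := (hp₂' (U - u) (mem_Icc.2 ⟨by omega, by omega⟩)).1
  have h1 : p₁ u < 1 := by
    rcases Nat.eq_zero_or_pos u with rfl | h
    · simp [hp₁]
    · exact (hp₁' u (mem_Icc.2 ⟨h, hu.le⟩)).2
  simpa [phi, bern] using mul_pos (sub_pos.2 h1) h2

theorem phi_true_false_pos (hp₂ : p₂ 0 = 0)
    (hp₁' : ∀ u ∈ Icc 1 U, 0 < p₁ u ∧ p₁ u < 1) (hp₂' : ∀ u ∈ Icc 1 U, 0 < p₂ u ∧ p₂ u < 1)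
    {u : ℕ} (hu : u < U) : 0 < phi U p₁ p₂ true false (u + 1) := by
  have h1 := (hp₁' (u + 1) (mem_Icc.2 ⟨by omega, by omega⟩)).1
  have h2 : p₂ (U - (u + 1)) < 1 := by
    rcases Nat.eq_zero_or_pos (U - (u + 1)) with h | h
    · simp [h, hp₂]
    · exact (hp₂' _ (mem_Icc.2 ⟨h, by omega⟩)).2
  simpa [phi, bern] using mul_pos h1 (sub_pos.2 h2)

/-- Detailed balance: in a stationary birth–death chain the flows across each edge are equal. -/
theorem IsStationary.detailed_balance (hπ : IsStationary U p₁ p₂ π) (hp₁ : p₁ 0 = 0) :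
    ∀ u < U, π u * phi U p₁ p₂ false true u = π (u + 1) * phi U p₁ p₂ true false (u + 1) := by
  intro u
  induction u with
  | zero =>
    intro hu
    have h := hπ.fixed_point 0 hu.le
    have h0 : phi U p₁ p₂ true false 0 = 0 := by simp [phi, bern, hp₁]
    rw [phi_stay_eq, if_pos rfl, if_neg hu.ne, h0] at h
    linarith
  | succ u ih =>
    intro hu
    have h := hπ.fixed_point (u + 1) hu.le
    have := ih (by omega)
    rw [phi_stay_eq, if_neg (by omega), if_neg hu.ne, Nat.add_sub_cancel] at h
    linarith

theorem IsStationary.pos (hπ : IsStationary U p₁ p₂ π) (hp₁ : p₁ 0 = 0) (hp₂ : p₂ 0 = 0)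
    (hp₁' : ∀ u ∈ Icc 1 U, 0 < p₁ u ∧ p₁ u < 1) (hp₂' : ∀ u ∈ Icc 1 U, 0 < p₂ u ∧ p₂ u < 1) :
    ∀ u ≤ U, 0 < π u := by
  have key : ∀ u < U, (0 < π u ↔ 0 < π (u + 1)) := by
    intro u hu
    have h := hπ.detailed_balance hp₁ u hu
    have a := phi_false_true_pos hp₁ hp₁' hp₂' hu
    have b := phi_true_false_pos hp₂ hp₁' hp₂' hu
    rw [← mul_pos_iff_of_pos_right a, h, mul_pos_iff_of_pos_right b]
  have all : ∀ u ≤ U, (0 < π 0 ↔ 0 < π u) := by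
    intro u
    induction u with
    | zero => simp
    | succ u ih => exact fun hu => (ih (by omega)).trans (key u (by omega))
  by_contra! hcon
  obtain ⟨u, hu, hle⟩ := hcon
  have h0 : ¬ 0 < π 0 := fun h => absurd ((all u hu).1 h) (not_lt.2 hle)
  have : ∑ v ∈ Icc 0 U, π v ≤ 0 := sum_nonpos fun v hv =>
    not_lt.1 fun h => h0 ((all v (mem_Icc.1 hv).2).2 h)
  linarith [hπ.sum_eq_one]

/-- The increments of the solution of the Poisson equation with right-hand side `g`, obtained by
solving the equation at the states `0, 1, 2, …` in turn. -/
noncomputable def poissonIncrement (U : ℕ) (p₁ p₂ g : ℕ → ℝ) : ℕ → ℝ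
  | 0 => -g 0 / phi U p₁ p₂ false true 0
  | u + 1 => (phi U p₁ p₂ true false (u + 1) * poissonIncrement U p₁ p₂ g u - g (u + 1))
      / phi U p₁ p₂ false true (u + 1)

/-- The Poisson equation of the chain is solvable for every function `f`, centred at its stationary
mean: `h` compensates the drift of the sum of the values of `f` along the chain. The equation at
the last state `U` is not used in the construction; it follows from the others because `f` has been
centred. -/
theorem IsStationary.exists_poisson (hπ : IsStationary U p₁ p₂ π) (hp₁ : p₁ 0 = 0)
    (hp₂ : p₂ 0 = 0) (hp₁' : ∀ u ∈ Icc 1 U, 0 < p₁ u ∧ p₁ u < 1)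
    (hp₂' : ∀ u ∈ Icc 1 U, 0 < p₂ u ∧ p₂ u < 1) (f : ℕ → ℝ) :
    ∃ h : ℕ → ℝ, ∀ u ≤ U, f u - ∑ v ∈ Icc 0 U, π v * f v
      + phi U p₁ p₂ false true u * (h (u + 1) - h u)
      + phi U p₁ p₂ true false u * (h (u - 1) - h u) = 0 := by
  set J := ∑ v ∈ Icc 0 U, π v * f v with hJ
  set g : ℕ → ℝ := fun u => f u - J with hg
  set d := poissonIncrement U p₁ p₂ g with hd
  have e0 : 0 < U → phi U p₁ p₂ false true 0 * d 0 = -g 0 := fun hU => by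
    rw [hd, poissonIncrement, mul_div_cancel₀ _ (phi_false_true_pos hp₁ hp₁' hp₂' hU).ne']
  have eS : ∀ u, u + 1 < U → phi U p₁ p₂ false true (u + 1) * d (u + 1)
      = phi U p₁ p₂ true false (u + 1) * d u - g (u + 1) := fun u hu => by
    rw [hd, poissonIncrement, mul_div_cancel₀ _ (phi_false_true_pos hp₁ hp₁' hp₂' hu).ne']
  -- the weighted sum of the equations telescopes
  have tel : ∀ u < U, π u * phi U p₁ p₂ false true u * d u = -∑ v ∈ range (u + 1), π v * g v := by
    intro u
    induction u with
    | zero => intro hu; rw [mul_assoc, e0 hu]; simp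
    | succ u ih =>
      intro hu
      have h1 := ih (by omega)
      have h2 := hπ.detailed_balance hp₁ u (by omega)
      rw [sum_range_succ, mul_assoc, eS u hu]
      rw [h2] at h1
      linarith
  have hzero : ∑ v ∈ range (U + 1), π v * g v = 0 := by
    have hI : range (U + 1) = Icc 0 U := by ext; simp
    simp only [hI, hg, mul_sub, sum_sub_distrib, ← sum_mul, hπ.sum_eq_one, ← hJ]
    ring
  have htop : phi U p₁ p₂ false true U = 0 := by simp [phi, bern, hp₂]
  have hbot : phi U p₁ p₂ true false 0 = 0 := by simp [phi, bern, hp₁]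
  refine ⟨fun u => ∑ j ∈ range u, d j, fun u hu => ?_⟩
  rcases Nat.eq_zero_or_pos u with rfl | hu0
  · rcases Nat.eq_zero_or_pos U with rfl | hU
    · rw [htop, hbot]
      have hs := hπ.sum_eq_one
      simp only [zero_add, range_one, sum_singleton, hg, Icc_self] at hzero hs
      rw [hs] at hzero
      linarith
    · have := e0 hU
      simp only [hg] at this
      simp only [hbot, zero_add, range_one, sum_singleton, range_zero, sum_empty]
      linarith
  · obtain ⟨u, rfl⟩ := Nat.exists_eq_succ_of_ne_zero hu0.ne'
    simp only [Nat.succ_eq_add_one, Nat.add_sub_cancel, sum_range_succ]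
    rcases hu.lt_or_eq with h | h
    · have := eS u h
      simp only [hg] at this
      linarith
    · have h' : u + 1 = U := h
      have h1 := tel u (by omega)
      rw [hπ.detailed_balance hp₁ u (by omega), mul_assoc] at h1
      rw [← h', sum_range_succ] at hzero
      have hpos : 0 < π (u + 1) := hπ.pos hp₁ hp₂ hp₁' hp₂' _ hu
      have h3 : π (u + 1) * (phi U p₁ p₂ true false (u + 1) * d u - g (u + 1)) = 0 := by
        linarith
      have h4 := (mul_eq_zero.1 h3).resolve_left hpos.ne'
      rw [← h'] at htop
      rw [← h'] at h4 ⊢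
      simp only [hg] at h4
      rw [htop]
      linarith

end Chain

/-! ### Strategies that depend on the energy only -/

/-- The behaviour of a node in one channel use: the symbol it sends in each of its energy states. -/
abbrev StepRule (U : ℕ) := Fin (U + 1) → Bool

/-- The symbol sent by a node with `v` energy units, forced to be a zero if `v = 0`. For `v ≤ U`,
the only relevant case, `Fin.ofNat (U + 1) v` is `v` itself. -/
def StepRule.send {U : ℕ} (a : StepRule U) (v : ℕ) : Bool :=
  decide (v ≠ 0) && a (Fin.ofNat (U + 1) v)

theorem StepRule.one_le_of_send {U : ℕ} {a : StepRule U} {v : ℕ} (h : a.send v = true) :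
    1 ≤ v := by
  simp [StepRule.send] at h
  omega

/-- Node 1's energy after a channel use that begins with `u` units at Node 1 and in which the two
nodes follow the rules `a` and `b`. -/
def nextEnergy {U : ℕ} (u : ℕ) (a b : StepRule U) : ℕ :=
  u - (a.send u).toNat + (b.send (U - u)).toNat

theorem nextEnergy_le {U u : ℕ} (hu : u ≤ U) (a b : StepRule U) : nextEnergy u a b ≤ U := by
  unfold nextEnergy
  rcases h : b.send (U - u) with _ | _
  · simp; omega
  · have := StepRule.one_le_of_send h
    simp; omega

/-- Node 1's energy before each channel use, if it is `u` at first and the nodes follow the sequences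
of rules `s` and `t`. -/
def trajectory {U : ℕ} (s t : ℕ → StepRule U) (u : ℕ) : ℕ → ℕ
  | 0 => u
  | k + 1 => nextEnergy (trajectory s t u k) (s k) (t k)

theorem trajectory_le {U u : ℕ} (hu : u ≤ U) (s t : ℕ → StepRule U) (k : ℕ) :
    trajectory s t u k ≤ U := by
  induction k with
  | zero => exact hu
  | succ k ih => exact nextEnergy_le ih _ _

theorem trajectory_succ' {U : ℕ} (s t : ℕ → StepRule U) (u k : ℕ) :
    trajectory s t u (k + 1)
      = trajectory (fun i => s (i + 1)) (fun i => t (i + 1)) (nextEnergy u (s 0) (t 0)) k := by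
  induction k with
  | zero => rfl
  | succ k ih => rw [trajectory, ih, trajectory]

/-- Node 1's energy, as computed by Node 1 from its own rules and its received symbols. -/
def energyFrom₁ {U : ℕ} (s : ℕ → StepRule U) (u : ℕ) : List Bool → ℕ
  | [] => u
  | y :: l => energyFrom₁ s u l - ((s l.length).send (energyFrom₁ s u l)).toNat + y.toNat

/-- Node 1's energy, as computed by Node 2 from its own rules and its received symbols. -/
def energyFrom₂ {U : ℕ} (t : ℕ → StepRule U) (u : ℕ) : List Bool → ℕ
  | [] => u
  | x :: l => energyFrom₂ t u l - x.toNat + ((t l.length).send (U - energyFrom₂ t u l)).toNat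

/-- The encoders that follow, for each message, a sequence of rules. Each node knows the energy
state at all times. -/
def ruleEncoders {U M₁ M₂ : ℕ} (u : ℕ) (s : Fin M₁ → ℕ → StepRule U)
    (t : Fin M₂ → ℕ → StepRule U) : Encoders M₁ M₂ where
  f₁ m l := (s m l.length).send (energyFrom₁ (s m) u l)
  f₂ m l := (t m l.length).send (U - energyFrom₂ (t m) u l)

section RuleEncoders

variable {U M₁ M₂ : ℕ} (u : ℕ) (s : Fin M₁ → ℕ → StepRule U) (t : Fin M₂ → ℕ → StepRule U)
  (m₁ : Fin M₁) (m₂ : Fin M₂)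

theorem Encoders.length_past (e : Encoders M₁ M₂) (k : ℕ) :
    (e.past m₁ m₂ k).1.length = k ∧ (e.past m₁ m₂ k).2.length = k := by
  induction k with
  | zero => exact ⟨rfl, rfl⟩
  | succ k ih => simp [Encoders.past, ih]

theorem energyFrom_past (k : ℕ) :
    energyFrom₁ (s m₁) u ((ruleEncoders u s t).past m₁ m₂ k).2
        = trajectory (s m₁) (t m₂) u k ∧
      energyFrom₂ (t m₂) u ((ruleEncoders u s t).past m₁ m₂ k).1
        = trajectory (s m₁) (t m₂) u k := by
  induction k with
  | zero => exact ⟨rfl, rfl⟩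
  | succ k ih =>
    have hl := (ruleEncoders u s t).length_past m₁ m₂ k
    obtain ⟨ih₁, ih₂⟩ := ih
    set e := ruleEncoders u s t
    have hx : e.f₁ m₁ (e.past m₁ m₂ k).2 = (s m₁ k).send (trajectory (s m₁) (t m₂) u k) := by
      rw [← ih₁, ← congrArg (s m₁) hl.2]; rfl
    have hy : e.f₂ m₂ (e.past m₁ m₂ k).1
        = (t m₂ k).send (U - trajectory (s m₁) (t m₂) u k) := by
      rw [← ih₂, ← congrArg (t m₂) hl.1]; rfl
    simp only [Encoders.past, energyFrom₁, energyFrom₂, hl, ih₁, ih₂, hx, hy, trajectory,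
      nextEnergy, and_self]

theorem ruleEncoders_x₁ (k : ℕ) : (ruleEncoders u s t).x₁ m₁ m₂ k
    = (s m₁ k).send (trajectory (s m₁) (t m₂) u k) := by
  rw [← (energyFrom_past u s t m₁ m₂ k).1,
    ← congrArg (s m₁) ((ruleEncoders u s t).length_past m₁ m₂ k).2]
  rfl

theorem ruleEncoders_x₂ (k : ℕ) : (ruleEncoders u s t).x₂ m₁ m₂ k
    = (t m₂ k).send (U - trajectory (s m₁) (t m₂) u k) := by
  rw [← (energyFrom_past u s t m₁ m₂ k).2,
    ← congrArg (t m₂) ((ruleEncoders u s t).length_past m₁ m₂ k).1]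
  rfl

theorem ruleEncoders_energy (k : ℕ) : (ruleEncoders u s t).energy m₁ m₂ u k
    = trajectory (s m₁) (t m₂) u k := by
  induction k with
  | zero => rfl
  | succ k ih =>
    rw [Encoders.energy, ih, ruleEncoders_x₁, ruleEncoders_x₂, trajectory, nextEnergy]

end RuleEncoders

/-- The sequence of rules `s` prescribes the symbols `x 0, …, x (n - 1)` to a node whose energy runs
through the states `v 0, …, v (n - 1)`. -/
def Prescribes {U : ℕ} (s : ℕ → StepRule U) (n : ℕ) (v : ℕ → ℕ) (x : ℕ → Bool) : Prop :=
  ∀ k < n, (s k).send (v k) = x k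

/-- If two messages of Node 1 lead to the same symbols received by Node 2, then the words of the two
messages prescribe the same symbols along the path of energy states of the first. -/
theorem send_eq_of_past_fst_eq {U M₁ M₂ : ℕ} (u : ℕ) (s : Fin M₁ → ℕ → StepRule U)
    (t : Fin M₂ → ℕ → StepRule U) {m₁ m₁' : Fin M₁} {m₂ : Fin M₂} {n : ℕ}
    (h : ((ruleEncoders u s t).past m₁' m₂ n).1 = ((ruleEncoders u s t).past m₁ m₂ n).1) :
    Prescribes (s m₁') n (trajectory (s m₁) (t m₂) u)
      fun k => (s m₁ k).send (trajectory (s m₁) (t m₂) u k) := by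
  induction n with
  | zero => intro k hk; omega
  | succ n ih =>
    obtain ⟨hx, hp⟩ := List.cons.inj h
    intro k hk
    rcases Nat.lt_succ_iff_lt_or_eq.1 hk with hk | rfl
    · exact ih hp k hk
    · have hx' : (ruleEncoders u s t).x₁ m₁' m₂ k = (ruleEncoders u s t).x₁ m₁ m₂ k := hx
      have htr : trajectory (s m₁') (t m₂) u k = trajectory (s m₁) (t m₂) u k := by
        rw [← (energyFrom_past u s t m₁' m₂ k).2, hp, (energyFrom_past u s t m₁ m₂ k).2]
      rwa [ruleEncoders_x₁, ruleEncoders_x₁, htr] at hx'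

theorem send_eq_of_past_snd_eq {U M₁ M₂ : ℕ} (u : ℕ) (s : Fin M₁ → ℕ → StepRule U)
    (t : Fin M₂ → ℕ → StepRule U) {m₁ : Fin M₁} {m₂ m₂' : Fin M₂} {n : ℕ}
    (h : ((ruleEncoders u s t).past m₁ m₂' n).2 = ((ruleEncoders u s t).past m₁ m₂ n).2) :
    Prescribes (t m₂') n (fun k => U - trajectory (s m₁) (t m₂) u k)
      fun k => (t m₂ k).send (U - trajectory (s m₁) (t m₂) u k) := by
  induction n with
  | zero => intro k hk; omega
  | succ n ih =>
    obtain ⟨hx, hp⟩ := List.cons.inj h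
    intro k hk
    rcases Nat.lt_succ_iff_lt_or_eq.1 hk with hk | rfl
    · exact ih hp k hk
    · have hx' : (ruleEncoders u s t).x₂ m₁ m₂' k = (ruleEncoders u s t).x₂ m₁ m₂ k := hx
      have htr : trajectory (s m₁) (t m₂') u k = trajectory (s m₁) (t m₂) u k := by
        rw [← (energyFrom_past u s t m₁ m₂' k).1, hp, (energyFrom_past u s t m₁ m₂ k).1]
      rwa [ruleEncoders_x₂, ruleEncoders_x₂, htr] at hx'

theorem numMessages_pos (n : ℕ) (R : ℝ) : 0 < numMessages n R :=
  Nat.ceil_pos.2 (by positivity)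

open Classical in
/-- The code that follows given sequences of rules and decodes to any message that is consistent
with the received symbols. -/
noncomputable def ruleCode {U u₀ : ℕ} (n : ℕ) (R₁ R₂ : ℝ)
    (s : Fin (numMessages n R₁) → ℕ → StepRule U)
    (t : Fin (numMessages n R₂) → ℕ → StepRule U) : Code U u₀ n R₁ R₂ where
  toEncoders := ruleEncoders u₀ s t
  g₁ m₁ l := if h : ∃ m₂, ((ruleEncoders u₀ s t).past m₁ m₂ n).2 = l then h.choose
    else ⟨0, numMessages_pos n R₂⟩
  g₂ m₂ l := if h : ∃ m₁, ((ruleEncoders u₀ s t).past m₁ m₂ n).1 = l then h.choose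
    else ⟨0, numMessages_pos n R₁⟩
  alphabet₁ m₁ m₂ k _ h := by
    rw [ruleEncoders_energy]
    rw [ruleEncoders_x₁] at h
    exact StepRule.one_le_of_send h
  alphabet₂ m₁ m₂ k _ h := by
    rw [ruleEncoders_energy]
    rw [ruleEncoders_x₂] at h
    exact StepRule.one_le_of_send h

open Classical in
theorem ruleCode_errorProb_le {U u₀ : ℕ} (n : ℕ) (R₁ R₂ : ℝ)
    (s : Fin (numMessages n R₁) → ℕ → StepRule U)
    (t : Fin (numMessages n R₂) → ℕ → StepRule U) :
    (ruleCode (u₀ := u₀) n R₁ R₂ s t).errorProb ≤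
      ((univ.filter fun m : Fin (numMessages n R₁) × Fin (numMessages n R₂) =>
        (∃ m', m' ≠ m.1 ∧ Prescribes (s m') n (trajectory (s m.1) (t m.2) u₀)
          fun k => (s m.1 k).send (trajectory (s m.1) (t m.2) u₀ k)) ∨
        (∃ m', m' ≠ m.2 ∧ Prescribes (t m') n (fun k => U - trajectory (s m.1) (t m.2) u₀ k)
          fun k => (t m.2 k).send (U - trajectory (s m.1) (t m.2) u₀ k))).card : ℝ) /
        ((numMessages n R₁ : ℝ) * (numMessages n R₂ : ℝ)) := by
  refine div_le_div_of_nonneg_right (Nat.cast_le.2 (card_le_card ?_)) (by positivity)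
  refine monotone_filter_right _ fun m _ => ?_
  rintro (h | h)
  · right
    have hex : ∃ m₂, ((ruleEncoders u₀ s t).past m.1 m₂ n).2
        = ((ruleEncoders u₀ s t).past m.1 m.2 n).2 := ⟨m.2, rfl⟩
    simp only [ruleCode, dif_pos hex] at h
    exact ⟨_, h, send_eq_of_past_snd_eq u₀ s t hex.choose_spec⟩
  · left
    have hex : ∃ m₁, ((ruleEncoders u₀ s t).past m₁ m.2 n).1
        = ((ruleEncoders u₀ s t).past m.1 m.2 n).1 := ⟨m.1, rfl⟩
    simp only [ruleCode, dif_pos hex] at h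
    exact ⟨_, h, send_eq_of_past_fst_eq u₀ s t hex.choose_spec⟩

/-! ### Random words of rules -/

theorem sum_bern (p : ℝ) : ∑ x, bern p x = 1 := by
  simp [bern]

theorem bern_nonneg {p : ℝ} (h0 : 0 ≤ p) (h1 : p ≤ 1) (x : Bool) : 0 ≤ bern p x := by
  cases x <;> simp [bern, h0, h1]

/-- The probability of a rule that sends a one in state `v` with probability `p v`, independently
for the different states. -/
noncomputable def StepRule.weight {U : ℕ} (p : ℕ → ℝ) (a : StepRule U) : ℝ :=
  ∏ v : Fin (U + 1), bern (p v) (a v)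

/-- The probability of a word of `n` independent rules. -/
noncomputable def wordWeight {U n : ℕ} (p : ℕ → ℝ) (w : Fin n → StepRule U) : ℝ :=
  ∏ k, (w k).weight p

/-- A finite word of rules as an infinite sequence; the rules after its end never send a one. -/
def extend {U n : ℕ} (w : Fin n → StepRule U) : ℕ → StepRule U :=
  fun k => if h : k < n then w ⟨k, h⟩ else fun _ => false

/-- The sequence of rules that begins with `a` and goes on with `s`. -/
def consRule {U : ℕ} (a : StepRule U) (s : ℕ → StepRule U) : ℕ → StepRule U
  | 0 => a
  | k + 1 => s k

theorem trajectory_consRule_succ {U : ℕ} (a b : StepRule U) (s t : ℕ → StepRule U) (u k : ℕ) :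
    trajectory (consRule a s) (consRule b t) u (k + 1) = trajectory s t (nextEnergy u a b) k :=
  trajectory_succ' _ _ u k

section Words

variable {U : ℕ} {p : ℕ → ℝ}

theorem StepRule.weight_nonneg (h : ∀ v ≤ U, 0 ≤ p v ∧ p v ≤ 1) (a : StepRule U) :
    0 ≤ a.weight p :=
  prod_nonneg fun v _ =>
    bern_nonneg (h v (Nat.lt_succ_iff.1 v.2)).1 (h v (Nat.lt_succ_iff.1 v.2)).2 _

theorem sum_stepRule_weight : ∑ a : StepRule U, a.weight p = 1 :=
  sum_prod_eq_one (fun v : Fin (U + 1) => bern (p v)) fun _ => sum_bern _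

theorem sum_wordWeight (n : ℕ) : ∑ w : Fin n → StepRule U, wordWeight p w = 1 :=
  sum_prod_eq_one (fun _ => StepRule.weight p) fun _ => sum_stepRule_weight

theorem wordWeight_nonneg (h : ∀ v ≤ U, 0 ≤ p v ∧ p v ≤ 1) {n : ℕ} (w : Fin n → StepRule U) :
    0 ≤ wordWeight p w :=
  prod_nonneg fun k _ => (w k).weight_nonneg h

/-- The symbol sent by a random rule in state `v` is a Bernoulli variable of parameter `p v`; in
state `0` this holds because `p 0 = 0`. -/
theorem sum_weight_mul_send (hp : p 0 = 0) {v : ℕ} (hv : v ≤ U) (G : Bool → ℝ) :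
    ∑ a : StepRule U, a.weight p * G (a.send v) = ∑ x, bern (p v) x * G x := by
  rcases Nat.eq_zero_or_pos v with rfl | h
  · simp [StepRule.send, ← sum_mul, sum_stepRule_weight, hp, bern]
  · have hval : ((Fin.ofNat (U + 1) v : Fin (U + 1)) : ℕ) = v := by
      simp [Fin.ofNat, Nat.mod_eq_of_lt (Nat.lt_succ_of_le hv)]
    have := sum_prod_mul_eval (fun v : Fin (U + 1) => bern (p v)) (fun _ => sum_bern _)
      (Fin.ofNat (U + 1) v) G
    rw [hval] at this
    rw [← this]
    refine sum_congr rfl fun a _ => ?_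
    simp [StepRule.weight, StepRule.send, h.ne']

theorem sum_wordWeight_succ (n : ℕ) (F : (ℕ → StepRule U) → ℝ) :
    ∑ w : Fin (n + 1) → StepRule U, wordWeight p w * F (extend w)
      = ∑ a : StepRule U, a.weight p * ∑ w : Fin n → StepRule U,
          wordWeight p w * F (consRule a (extend w)) := by
  rw [← (Fin.consEquiv fun _ => StepRule U).sum_comp, Fintype.sum_prod_type]
  refine sum_congr rfl fun a _ => ?_
  rw [mul_sum]
  refine sum_congr rfl fun w _ => ?_
  have : extend (Fin.cons a w : Fin (n + 1) → StepRule U)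
      = consRule a (extend w) := by
    funext k
    cases k with
    | zero => simp [extend, consRule]
    | succ k =>
      by_cases h : k < n
      · simp only [extend, consRule, h, Nat.succ_lt_succ_iff, dif_pos]
        exact Fin.cons_succ (α := fun _ => StepRule U) a w ⟨k, h⟩
      · simp [extend, consRule, h]
  change (∏ k, StepRule.weight p ((Fin.cons a w : Fin (n + 1) → StepRule U) k))
    * F (extend (Fin.cons a w : Fin (n + 1) → StepRule U)) = _
  simp only [this, wordWeight, Fin.prod_univ_succ, Fin.cons_zero, Fin.cons_succ, mul_assoc]

open Classical in
/-- The probability that a random word prescribes given symbols along a given path of states. -/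
theorem sum_wordWeight_consistent (hp : p 0 = 0) {n : ℕ} {v : ℕ → ℕ} (hv : ∀ k, v k ≤ U)
    (x : ℕ → Bool) :
    ∑ w : Fin n → StepRule U, wordWeight p w *
        (if Prescribes (extend w) n v x then 1 else 0)
      = ∏ k ∈ range n, bern (p (v k)) (x k) := by
  have h : ∀ w : Fin n → StepRule U, wordWeight p w *
      (if Prescribes (extend w) n v x then 1 else 0)
      = ∏ k : Fin n, ((w k).weight p * if (w k).send (v k) = x k then 1 else 0) := by
    intro w
    rw [prod_mul_distrib, wordWeight]
    congr 1
    rw [prod_ite_zero]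
    simp only [Prescribes, prod_const_one, mem_univ, true_implies, Fin.forall_iff]
    congr 1
    refine propext (forall₂_congr fun k hk => ?_)
    simp [extend, hk]
  simp only [h]
  rw [prod_range, ← Fintype.piFinset_univ, sum_prod_piFinset univ
    (fun (k : Fin n) (a : StepRule U) => a.weight p * if a.send (v k) = x k then (1 : ℝ) else 0)]
  refine prod_congr rfl fun k _ => ?_
  rw [sum_weight_mul_send hp (hv k) (fun y => if y = x k then 1 else 0)]
  simp

end Words

/-! ### The law of large numbers along the energy path -/

section LawOfLargeNumbers

variable {U : ℕ} {p₁ p₂ : ℕ → ℝ}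

/-- The sum of `r u x y`, over the first `n` channel uses, where `u` is the energy state and `x` and
`y` are the symbols sent. -/
def pathSum {U : ℕ} (r : ℕ → Bool → Bool → ℝ) (s t : ℕ → StepRule U) (u n : ℕ) : ℝ :=
  ∑ k ∈ range n, r (trajectory s t u k) ((s k).send (trajectory s t u k))
    ((t k).send (U - trajectory s t u k))

/-- If `h` makes the increments `r + Δh` centred in every state, then the sum of the `r` along the
path, corrected by `h`, is a martingale, so that its second moment grows at most linearly. The
induction is on the first channel use. -/
theorem second_moment_le (hp₁ : p₁ 0 = 0) (hp₂ : p₂ 0 = 0)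
    (hb₁ : ∀ v ≤ U, 0 ≤ p₁ v ∧ p₁ v ≤ 1) (hb₂ : ∀ v ≤ U, 0 ≤ p₂ v ∧ p₂ v ≤ 1)
    (r : ℕ → Bool → Bool → ℝ) (h : ℕ → ℝ) {B : ℝ}
    (hcent : ∀ u ≤ U, ∑ x, ∑ y, phi U p₁ p₂ x y u
      * (r u x y + h (u - x.toNat + y.toNat) - h u) = 0)
    (hB : ∀ u ≤ U, ∀ x y, (r u x y + h (u - x.toNat + y.toNat) - h u) ^ 2 ≤ B) (n : ℕ) :
    ∀ u ≤ U, ∀ c : ℝ,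
      ∑ w₁ : Fin n → StepRule U, wordWeight p₁ w₁ * ∑ w₂ : Fin n → StepRule U, wordWeight p₂ w₂ *
        (c + pathSum r (extend w₁) (extend w₂) u n
          + h (trajectory (extend w₁) (extend w₂) u n)) ^ 2 ≤ (c + h u) ^ 2 + n * B := by
  induction n with
  | zero => intro u _ c; simp [pathSum, trajectory, wordWeight]
  | succ n ih =>
    intro u hu c
    have hstep : ∀ (a b : StepRule U) (s t : ℕ → StepRule U),
        c + pathSum r (consRule a s) (consRule b t) u (n + 1)
          + h (trajectory (consRule a s) (consRule b t) u (n + 1))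
        = (c + r u (a.send u) (b.send (U - u))) + pathSum r s t (nextEnergy u a b) n
          + h (trajectory s t (nextEnergy u a b) n) := by
      intro a b s t
      simp only [pathSum, sum_range_succ', trajectory_consRule_succ, consRule]
      simp only [trajectory]
      ring
    have hle : ∀ a b : StepRule U,
        ∑ w₁ : Fin n → StepRule U, wordWeight p₁ w₁ * ∑ w₂ : Fin n → StepRule U,
          wordWeight p₂ w₂ *
          ((c + r u (a.send u) (b.send (U - u)))
            + pathSum r (extend w₁) (extend w₂) (nextEnergy u a b) n
            + h (trajectory (extend w₁) (extend w₂) (nextEnergy u a b) n)) ^ 2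
        ≤ (c + r u (a.send u) (b.send (U - u)) + h (nextEnergy u a b)) ^ 2 + n * B :=
      fun a b => ih _ (nextEnergy_le hu a b) _
    calc _ = ∑ a : StepRule U, a.weight p₁ * ∑ b : StepRule U, b.weight p₂ *
          ∑ w₁ : Fin n → StepRule U, wordWeight p₁ w₁ * ∑ w₂ : Fin n → StepRule U,
            wordWeight p₂ w₂ *
            ((c + r u (a.send u) (b.send (U - u)))
              + pathSum r (extend w₁) (extend w₂) (nextEnergy u a b) n
              + h (trajectory (extend w₁) (extend w₂) (nextEnergy u a b) n)) ^ 2 := by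
          rw [sum_wordWeight_succ n fun s => ∑ w₂ : Fin (n + 1) → StepRule U, wordWeight p₂ w₂ *
            (c + pathSum r s (extend w₂) u (n + 1) + h (trajectory s (extend w₂) u (n + 1))) ^ 2]
          refine sum_congr rfl fun a _ => ?_
          congr 1
          rw [sum_congr rfl fun w₁ _ => congrArg (wordWeight p₁ w₁ * ·)
            (sum_wordWeight_succ n fun t =>
              (c + pathSum r (consRule a (extend w₁)) t u (n + 1)
                + h (trajectory (consRule a (extend w₁)) t u (n + 1))) ^ 2)]
          simp only [hstep, mul_sum]
          rw [sum_comm]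
          exact sum_congr rfl fun _ _ => sum_congr rfl fun _ _ => sum_congr rfl fun _ _ => by ring
      _ ≤ ∑ a : StepRule U, a.weight p₁ * ∑ b : StepRule U, b.weight p₂ *
          ((c + r u (a.send u) (b.send (U - u)) + h (nextEnergy u a b)) ^ 2 + n * B) := by
          gcongr with a _ b _
          · exact a.weight_nonneg hb₁
          · exact b.weight_nonneg hb₂
          · exact hle a b
      _ = ∑ x, bern (p₁ u) x * ∑ y, bern (p₂ (U - u)) y *
          ((c + r u x y + h (u - x.toNat + y.toNat)) ^ 2 + n * B) := by
          rw [← sum_weight_mul_send hp₁ hu fun x => ∑ y, bern (p₂ (U - u)) y *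
            ((c + r u x y + h (u - x.toNat + y.toNat)) ^ 2 + n * B)]
          refine sum_congr rfl fun a _ => ?_
          rw [← sum_weight_mul_send hp₂ (Nat.sub_le U u) fun y =>
            (c + r u (a.send u) y + h (u - (a.send u).toNat + y.toNat)) ^ 2 + n * B]
          rfl
      _ = (c + h u) ^ 2 + n * B + ∑ x, ∑ y, phi U p₁ p₂ x y u
            * (r u x y + h (u - x.toNat + y.toNat) - h u) ^ 2 := by
          -- expand the square around `c + h u`; the linear term vanishes by `hcent`
          have hc := hcent u hu
          simp only [Fintype.sum_bool, phi, bern] at hc ⊢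
          simp only [if_true, Bool.false_eq_true, if_false] at hc ⊢
          linear_combination 2 * (c + h u) * hc
      _ ≤ (c + h u) ^ 2 + n * B + ∑ x, ∑ y, phi U p₁ p₂ x y u * B := by
          gcongr with x _ y _
          · exact mul_nonneg (bern_nonneg (hb₁ u hu).1 (hb₁ u hu).2 x)
              (bern_nonneg (hb₂ _ (Nat.sub_le U u)).1 (hb₂ _ (Nat.sub_le U u)).2 y)
          · exact hB u hu x y
      _ = _ := by
          simp only [phi, Fintype.sum_bool, bern, if_true, Bool.false_eq_true, if_false]
          push_cast
          ring

/-- The sum of a function along the energy path deviates from its stationary mean with a second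
moment that grows at most linearly. -/
theorem IsStationary.exists_second_moment_le {π : ℕ → ℝ} (hπ : IsStationary U p₁ p₂ π)
    (hp₁ : p₁ 0 = 0) (hp₂ : p₂ 0 = 0)
    (hp₁' : ∀ u ∈ Icc 1 U, 0 < p₁ u ∧ p₁ u < 1) (hp₂' : ∀ u ∈ Icc 1 U, 0 < p₂ u ∧ p₂ u < 1)
    (hb₁ : ∀ v ≤ U, 0 ≤ p₁ v ∧ p₁ v ≤ 1) (hb₂ : ∀ v ≤ U, 0 ≤ p₂ v ∧ p₂ v ≤ 1)
    (l : ℕ → Bool → Bool → ℝ) {J : ℝ}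
    (hJ : J = ∑ u ∈ Icc 0 U, π u * ∑ x, ∑ y, phi U p₁ p₂ x y u * l u x y) :
    ∃ C : ℝ, 0 ≤ C ∧ ∀ u ≤ U, ∀ n : ℕ,
      ∑ w₁ : Fin n → StepRule U, wordWeight p₁ w₁ * ∑ w₂ : Fin n → StepRule U, wordWeight p₂ w₂ *
        (pathSum l (extend w₁) (extend w₂) u n - n * J) ^ 2 ≤ C * (n + 1) := by
  obtain ⟨h, hh⟩ := hπ.exists_poisson hp₁ hp₂ hp₁' hp₂'
    (fun u => ∑ x, ∑ y, phi U p₁ p₂ x y u * l u x y)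
  set r : ℕ → Bool → Bool → ℝ := fun u x y => l u x y - J with hr
  set D : ℕ → Bool → Bool → ℝ := fun u x y => (r u x y + h (u - x.toNat + y.toNat) - h u) ^ 2
  have hD0 : ∀ u x y, 0 ≤ D u x y := fun _ _ _ => sq_nonneg _
  set B := ∑ u ∈ range (U + 1), ∑ x, ∑ y, D u x y
  set H := ∑ u ∈ range (U + 1), h u ^ 2
  have hB : ∀ u ≤ U, ∀ x y, D u x y ≤ B := fun u hu x y =>
    calc D u x y ≤ ∑ y, D u x y := single_le_sum (f := D u x) (fun _ _ => hD0 _ _ _) (mem_univ y)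
      _ ≤ ∑ x, ∑ y, D u x y :=
        single_le_sum (f := fun x => ∑ y, D u x y)
          (fun _ _ => sum_nonneg fun _ _ => hD0 _ _ _) (mem_univ x)
      _ ≤ B := single_le_sum (f := fun u => ∑ x, ∑ y, D u x y)
          (fun _ _ => sum_nonneg fun _ _ => sum_nonneg fun _ _ => hD0 _ _ _)
          (mem_range.2 (Nat.lt_succ_of_le hu))
  have hH : ∀ u ≤ U, h u ^ 2 ≤ H := fun u hu =>
    single_le_sum (f := fun u => h u ^ 2) (fun _ _ => sq_nonneg _)
      (mem_range.2 (Nat.lt_succ_of_le hu))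
  have hB0 : 0 ≤ B := (hD0 0 true true).trans (hB 0 (Nat.zero_le _) _ _)
  have hH0 : 0 ≤ H := (sq_nonneg _).trans (hH 0 (Nat.zero_le _))
  have hcent : ∀ u ≤ U, ∑ x, ∑ y, phi U p₁ p₂ x y u
      * (r u x y + h (u - x.toNat + y.toNat) - h u) = 0 := by
    intro u hu
    have e := hh u hu
    rw [← hJ] at e
    have hphi := phi_stay_eq (U := U) (p₁ := p₁) (p₂ := p₂) u
    have h11 : phi U p₁ p₂ true true u * (h (u - 1 + 1) - h u) = 0 := by
      rcases Nat.eq_zero_or_pos u with rfl | hu0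
      · simp [phi, bern, hp₁]
      · simp [Nat.sub_add_cancel hu0]
    simp only [Fintype.sum_bool, Bool.toNat_true, Bool.toNat_false, hr, Nat.sub_zero,
      Nat.add_zero] at e ⊢
    linear_combination e + h11 - J * hphi
  refine ⟨2 * B + 8 * H, by positivity, fun u hu n => ?_⟩
  have hmain := second_moment_le hp₁ hp₂ hb₁ hb₂ r h hcent hB n u hu (-h u)
  have hpath : ∀ s t : ℕ → StepRule U, pathSum l s t u n - n * J = pathSum r s t u n := by
    intro s t
    simp [pathSum, hr, sum_sub_distrib]
  have hpt : ∀ s t : ℕ → StepRule U, (pathSum l s t u n - n * J) ^ 2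
      ≤ 2 * (-h u + pathSum r s t u n + h (trajectory s t u n)) ^ 2 + 8 * H := by
    intro s t
    rw [hpath]
    have h1 := hH u hu
    have h2 := hH _ (trajectory_le hu s t n)
    nlinarith [sq_nonneg (pathSum r s t u n + 2 * (h (trajectory s t u n) - h u)),
      sq_nonneg (h u + h (trajectory s t u n))]
  calc _ ≤ ∑ w₁ : Fin n → StepRule U, wordWeight p₁ w₁ * ∑ w₂ : Fin n → StepRule U,
        wordWeight p₂ w₂ * (2 * (-h u + pathSum r (extend w₁) (extend w₂) u n
          + h (trajectory (extend w₁) (extend w₂) u n)) ^ 2 + 8 * H) := by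
        gcongr with w₁ _ w₂ _
        · exact wordWeight_nonneg hb₁ w₁
        · exact wordWeight_nonneg hb₂ w₂
        · exact hpt _ _
    _ = 2 * (∑ w₁ : Fin n → StepRule U, wordWeight p₁ w₁ * ∑ w₂ : Fin n → StepRule U,
        wordWeight p₂ w₂ * (-h u + pathSum r (extend w₁) (extend w₂) u n
          + h (trajectory (extend w₁) (extend w₂) u n)) ^ 2) + 8 * H := by
        simp only [mul_add, sum_add_distrib, ← sum_mul, sum_wordWeight, one_mul,
          mul_left_comm _ (2 : ℝ), ← mul_sum]
    _ ≤ 2 * ((-h u + h u) ^ 2 + n * B) + 8 * H := by gcongr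
    _ ≤ (2 * B + 8 * H) * (n + 1) := by
        have : (0 : ℝ) ≤ n := n.cast_nonneg
        nlinarith [mul_nonneg this hH0]

open Classical in
/-- Chebyshev's inequality for the sum of a function along the energy path. -/
theorem sum_wordWeight_deviation_le {l : ℕ → Bool → Bool → ℝ} {J C : ℝ} {u n : ℕ}
    (hb₁ : ∀ v ≤ U, 0 ≤ p₁ v ∧ p₁ v ≤ 1) (hb₂ : ∀ v ≤ U, 0 ≤ p₂ v ∧ p₂ v ≤ 1)
    (hC : ∑ w₁ : Fin n → StepRule U, wordWeight p₁ w₁ * ∑ w₂ : Fin n → StepRule U,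
      wordWeight p₂ w₂ * (pathSum l (extend w₁) (extend w₂) u n - n * J) ^ 2 ≤ C * (n + 1))
    {δ : ℝ} (hδ : 0 < δ) (hn : 0 < n) :
    ∑ w₁ : Fin n → StepRule U, wordWeight p₁ w₁ * ∑ w₂ : Fin n → StepRule U, wordWeight p₂ w₂ *
      (if n * (J - δ) ≤ pathSum l (extend w₁) (extend w₂) u n then 0 else 1)
      ≤ C * (n + 1) / (n * δ) ^ 2 := by
  have hpos : (0 : ℝ) < (n * δ) ^ 2 := by positivity
  rw [le_div_iff₀ hpos]
  refine le_trans ?_ hC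
  simp only [sum_mul, mul_assoc]
  gcongr with w₁ _ w₂ _
  · exact wordWeight_nonneg hb₁ w₁
  · exact wordWeight_nonneg hb₂ w₂
  · split_ifs with hif
    · simpa using sq_nonneg _
    · rw [one_mul, sq_le_sq, abs_of_pos (by positivity)]
      refine le_trans ?_ (neg_le_abs _)
      linarith

end LawOfLargeNumbers

/-! ### Achievability -/

theorem sum_bern_mul_neg_log (p : ℝ) :
    ∑ x, bern p x * -Real.log (bern p x) = Real.binEntropy p := by
  simp [bern, Real.binEntropy, Real.log_inv, add_comm]

/-- The bound is an equality unless a factor vanishes; such a factor is bounded by `1`, because its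
logarithm has the value `0`. -/
theorem prod_bern_le_exp {q : ℕ → ℝ} (hq : ∀ k, 0 ≤ q k ∧ q k ≤ 1) (x : ℕ → Bool) (n : ℕ) :
    ∏ k ∈ range n, bern (q k) (x k)
      ≤ Real.exp (-∑ k ∈ range n, -Real.log (bern (q k) (x k))) := by
  rw [← sum_neg_distrib, Real.exp_sum]
  refine prod_le_prod (fun k _ => bern_nonneg (hq k).1 (hq k).2 _) fun k _ => ?_
  rw [neg_neg]
  exact Real.le_exp_log _

theorem numMessages_le {R : ℝ} (hR : 0 ≤ R) (n : ℕ) :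
    (numMessages n R : ℝ) ≤ 2 * Real.exp (n * (R * Real.log 2)) := by
  have h1 : (1 : ℝ) ≤ 2 ^ ((n : ℝ) * R) := Real.one_le_rpow one_le_two (by positivity)
  have h2 : (2 : ℝ) ^ ((n : ℝ) * R) = Real.exp (n * (R * Real.log 2)) := by
    rw [Real.rpow_def_of_pos two_pos]; ring_nf
  have := (Nat.ceil_lt_add_one (zero_le_one.trans h1)).le
  rw [numMessages, ← h2]
  linarith

/-- The union bound over the messages: the confusion probability `exp (-n (J - δ))` decays faster than
the number of messages grows. The decay is exponential; a bound of order `1 / n` is enough here. -/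
theorem numMessages_mul_exp_le {R J δ : ℝ} (hR : 0 ≤ R) (hδ : 0 < δ)
    (h : R * Real.log 2 + 2 * δ ≤ J) {n : ℕ} (hn : 0 < n) :
    numMessages n R * Real.exp (-(n * (J - δ))) ≤ 2 / (n * δ) := by
  have hx : (0 : ℝ) < n * δ := by positivity
  calc numMessages n R * Real.exp (-(n * (J - δ)))
      ≤ 2 * Real.exp (n * (R * Real.log 2)) * Real.exp (-(n * (J - δ))) := by
        gcongr; exact numMessages_le hR n
    _ = 2 * Real.exp (n * (R * Real.log 2) + -(n * (J - δ))) := by rw [mul_assoc, Real.exp_add]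
    _ ≤ 2 * Real.exp (-(n * δ)) := by
        gcongr
        have : (0 : ℝ) ≤ n := n.cast_nonneg
        nlinarith [mul_le_mul_of_nonneg_left h this]
    _ ≤ 2 / (n * δ) := by
        rw [Real.exp_neg, div_eq_mul_inv]
        gcongr
        linarith [Real.add_one_le_exp (n * δ)]

section Achievability

variable {U u₀ : ℕ} {p₁ p₂ π : ℕ → ℝ}

open Classical in
/-- Finite-length bound: if the stationary means of the two entropies exceed the rates, all in nats,
by at least `2 δ`, then there are codes of every length `n` whose error probability is at most of
order `1 / n`. -/
theorem exists_code_errorProb_le (hu₀ : u₀ ≤ U) (hp₁ : p₁ 0 = 0) (hp₂ : p₂ 0 = 0)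
    (hp₁' : ∀ u ∈ Icc 1 U, 0 < p₁ u ∧ p₁ u < 1) (hp₂' : ∀ u ∈ Icc 1 U, 0 < p₂ u ∧ p₂ u < 1)
    (hπ : IsStationary U p₁ p₂ π) {R₁ R₂ δ : ℝ} (hR₁ : 0 ≤ R₁) (hR₂ : 0 ≤ R₂) (hδ : 0 < δ)
    (h₁ : R₁ * Real.log 2 + 2 * δ ≤ ∑ u ∈ Icc 0 U, π u * Real.binEntropy (p₁ u))
    (h₂ : R₂ * Real.log 2 + 2 * δ ≤ ∑ u ∈ Icc 0 U, π u * Real.binEntropy (p₂ (U - u))) :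
    ∃ K : ℝ, ∀ n : ℕ, 0 < n → ∃ c : Code U u₀ n R₁ R₂, c.errorProb ≤ K / n := by
  have hb : ∀ p : ℕ → ℝ, p 0 = 0 → (∀ u ∈ Icc 1 U, 0 < p u ∧ p u < 1) →
      ∀ v ≤ U, 0 ≤ p v ∧ p v ≤ 1 := by
    intro p h0 h v hv
    rcases Nat.eq_zero_or_pos v with rfl | hv0
    · simp [h0]
    · have := h v (mem_Icc.2 ⟨hv0, hv⟩)
      exact ⟨this.1.le, this.2.le⟩
  have hb₁ := hb p₁ hp₁ hp₁'
  have hb₂ := hb p₂ hp₂ hp₂'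
  set J₁ := ∑ u ∈ Icc 0 U, π u * Real.binEntropy (p₁ u)
  set J₂ := ∑ u ∈ Icc 0 U, π u * Real.binEntropy (p₂ (U - u))
  let l₁ : ℕ → Bool → Bool → ℝ := fun u x _ => -Real.log (bern (p₁ u) x)
  let l₂ : ℕ → Bool → Bool → ℝ := fun u _ y => -Real.log (bern (p₂ (U - u)) y)
  obtain ⟨C₁, hC₁0, hC₁⟩ := hπ.exists_second_moment_le hp₁ hp₂ hp₁' hp₂' hb₁ hb₂ l₁ (J := J₁) (by
    refine sum_congr rfl fun u _ => ?_
    simp only [l₁, phi, mul_right_comm _ (bern (p₂ (U - u)) _), ← mul_sum, sum_bern, mul_one,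
      sum_bern_mul_neg_log])
  obtain ⟨C₂, hC₂0, hC₂⟩ := hπ.exists_second_moment_le hp₁ hp₂ hp₁' hp₂' hb₁ hb₂ l₂ (J := J₂) (by
    refine sum_congr rfl fun u _ => ?_
    simp only [l₂, phi, mul_assoc, ← mul_sum, sum_bern_mul_neg_log, ← sum_mul, sum_bern, one_mul])
  -- two terms from Chebyshev's inequality and two from the union bounds
  refine ⟨2 * C₁ / δ ^ 2 + 2 * C₂ / δ ^ 2 + 2 / δ + 2 / δ, fun n hn => ?_⟩
  have hn' : (0 : ℝ) < n := Nat.cast_pos.2 hn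
  have hn1 : (1 : ℝ) ≤ n := Nat.one_le_cast.2 hn
  let W := Fin n → StepRule U
  -- both information densities are near their stationary mean, or larger
  obtain ⟨T, hTdef⟩ : ∃ T : W → W → Prop, ∀ w₁ w₂, T w₁ w₂ ↔
      n * (J₁ - δ) ≤ pathSum l₁ (extend w₁) (extend w₂) u₀ n ∧
        n * (J₂ - δ) ≤ pathSum l₂ (extend w₁) (extend w₂) u₀ n := ⟨_, fun _ _ => Iff.rfl⟩
  let tr : W → W → ℕ → ℕ := fun w₁ w₂ => trajectory (extend w₁) (extend w₂) u₀
  obtain ⟨c₁, c₂, hc⟩ := exists_codebooks (W₁ := W) (W₂ := W) (wordWeight p₁) (wordWeight p₂)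
    (wordWeight_nonneg hb₁) (wordWeight_nonneg hb₂) (sum_wordWeight n) (sum_wordWeight n) T
    (fun w₂ w₁ w' => Prescribes (extend w') n (tr w₁ w₂)
      fun k => (extend w₁ k).send (tr w₁ w₂ k))
    (fun w₁ w₂ w' => Prescribes (extend w') n (fun k => U - tr w₁ w₂ k)
      fun k => (extend w₂ k).send (U - tr w₁ w₂ k))
    (q₁ := Real.exp (-(n * (J₁ - δ)))) (q₂ := Real.exp (-(n * (J₂ - δ))))
    (Real.exp_pos _).le (Real.exp_pos _).le
    (fun w₁ w₂ hT => by
      have htr := trajectory_le hu₀ (extend w₁) (extend w₂)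
      rw [sum_wordWeight_consistent hp₁ htr fun k => (extend w₁ k).send (tr w₁ w₂ k)]
      refine (prod_bern_le_exp (fun k => hb₁ _ (htr k)) _ n).trans ?_
      exact Real.exp_le_exp.2 (neg_le_neg ((hTdef _ _).1 hT).1))
    (fun w₁ w₂ hT => by
      have htr := trajectory_le hu₀ (extend w₁) (extend w₂)
      rw [sum_wordWeight_consistent hp₂ (fun k => Nat.sub_le U (tr w₁ w₂ k))
        fun k => (extend w₂ k).send (U - tr w₁ w₂ k)]
      refine (prod_bern_le_exp (fun k => hb₂ _ (Nat.sub_le U _)) _ n).trans ?_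
      exact Real.exp_le_exp.2 (neg_le_neg ((hTdef _ _).1 hT).2))
    (numMessages n R₁) (numMessages n R₂)
  refine ⟨ruleCode n R₁ R₂ (fun m => extend (c₁ m)) (fun m => extend (c₂ m)), ?_⟩
  refine (ruleCode_errorProb_le n R₁ R₂ _ _).trans ?_
  have hM₁ : (0 : ℝ) < numMessages n R₁ := Nat.cast_pos.2 (numMessages_pos n R₁)
  have hM₂ : (0 : ℝ) < numMessages n R₂ := Nat.cast_pos.2 (numMessages_pos n R₂)
  rw [div_le_iff₀ (mul_pos hM₁ hM₂), mul_comm]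
  refine hc.trans ?_
  refine mul_le_mul_of_nonneg_left ?_ (by positivity)
  have hT : ∑ w₁ : W, wordWeight p₁ w₁ * ∑ w₂ : W, wordWeight p₂ w₂ * (if T w₁ w₂ then 0 else 1)
      ≤ C₁ * (n + 1) / (n * δ) ^ 2 + C₂ * (n + 1) / (n * δ) ^ 2 := by
    have d₁ := sum_wordWeight_deviation_le hb₁ hb₂ (hC₁ u₀ hu₀ n) hδ hn
    have d₂ := sum_wordWeight_deviation_le hb₁ hb₂ (hC₂ u₀ hu₀ n) hδ hn
    refine le_trans ?_ (add_le_add d₁ d₂)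
    rw [← sum_add_distrib]
    simp only [← mul_add, ← sum_add_distrib]
    gcongr with w₁ _ w₂ _
    · exact wordWeight_nonneg hb₁ w₁
    · exact wordWeight_nonneg hb₂ w₂
    · by_cases ha : n * (J₁ - δ) ≤ pathSum l₁ (extend w₁) (extend w₂) u₀ n <;>
        by_cases hb : n * (J₂ - δ) ≤ pathSum l₂ (extend w₁) (extend w₂) u₀ n <;>
        simp [hTdef, ha, hb]
  have hdec : ∀ C : ℝ, 0 ≤ C → C * (n + 1) / (n * δ) ^ 2 ≤ 2 * C / δ ^ 2 / n := by
    intro C hC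
    rw [div_div, div_le_div_iff₀ (by positivity) (by positivity)]
    have : C * (n + 1) ≤ 2 * C * n := by nlinarith
    calc C * (n + 1) * (δ ^ 2 * n) ≤ 2 * C * n * (δ ^ 2 * n) := by gcongr
      _ = 2 * C * (n * δ) ^ 2 := by ring
  have e₁ := numMessages_mul_exp_le hR₁ hδ h₁ hn
  have e₂ := numMessages_mul_exp_le hR₂ hδ h₂ hn
  have f₁ := hdec C₁ hC₁0
  have f₂ := hdec C₂ hC₂0
  have g : (2 : ℝ) / (n * δ) = 2 / δ / n := by rw [div_div, mul_comm]
  rw [g] at e₁ e₂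
  simp only [add_div]
  linarith

/-- Rates strictly below the stationary means of the entropies, both converted to nats, are
achievable. -/
theorem achievable_of_lt (hu₀ : u₀ ≤ U) (hp₁ : p₁ 0 = 0) (hp₂ : p₂ 0 = 0)
    (hp₁' : ∀ u ∈ Icc 1 U, 0 < p₁ u ∧ p₁ u < 1) (hp₂' : ∀ u ∈ Icc 1 U, 0 < p₂ u ∧ p₂ u < 1)
    (hπ : IsStationary U p₁ p₂ π) {R₁ R₂ : ℝ} (hR₁ : 0 ≤ R₁) (hR₂ : 0 ≤ R₂)
    (h₁ : R₁ * Real.log 2 < ∑ u ∈ Icc 0 U, π u * Real.binEntropy (p₁ u))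
    (h₂ : R₂ * Real.log 2 < ∑ u ∈ Icc 0 U, π u * Real.binEntropy (p₂ (U - u))) :
    Achievable U u₀ R₁ R₂ := by
  refine ⟨hR₁, hR₂, fun ε hε => ?_⟩
  set J₁ := ∑ u ∈ Icc 0 U, π u * Real.binEntropy (p₁ u)
  set J₂ := ∑ u ∈ Icc 0 U, π u * Real.binEntropy (p₂ (U - u))
  have hδ : 0 < min ((J₁ - R₁ * Real.log 2) / 2) ((J₂ - R₂ * Real.log 2) / 2) :=
    lt_min (by linarith) (by linarith)
  obtain ⟨K, hK⟩ := exists_code_errorProb_le hu₀ hp₁ hp₂ hp₁' hp₂' hπ hR₁ hR₂ hδ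
    (by linarith [min_le_left ((J₁ - R₁ * Real.log 2) / 2) ((J₂ - R₂ * Real.log 2) / 2)])
    (by linarith [min_le_right ((J₁ - R₁ * Real.log 2) / 2) ((J₂ - R₂ * Real.log 2) / 2)])
  have hlim := tendsto_const_div_atTop_nhds_zero_nat K
  obtain ⟨N, hN⟩ := Filter.eventually_atTop.1 (hlim.eventually_le_const hε)
  refine ⟨max N 1, fun n hn => ?_⟩
  obtain ⟨c, hc⟩ := hK n ((le_max_right N 1).trans hn)
  exact ⟨c, hc.trans (hN n ((le_max_left N 1).trans hn))⟩

end Achievability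

theorem mem_closure_of_forall_lt {S : Set (ℝ × ℝ)} {I₁ I₂ R₁ R₂ : ℝ} (hI₁ : 0 < I₁) (hI₂ : 0 < I₂)
    (hR₁ : 0 ≤ R₁) (hR₂ : 0 ≤ R₂) (h₁ : R₁ ≤ I₁) (h₂ : R₂ ≤ I₂)
    (hS : ∀ r₁ r₂, 0 ≤ r₁ → 0 ≤ r₂ → r₁ < I₁ → r₂ < I₂ → (r₁, r₂) ∈ S) :
    (R₁, R₂) ∈ closure S := by
  have hsub : Set.Ico 0 I₁ ×ˢ Set.Ico 0 I₂ ⊆ S := fun r hr =>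
    hS r.1 r.2 hr.1.1 hr.2.1 hr.1.2 hr.2.2
  refine closure_mono hsub ?_
  rw [closure_prod_eq, closure_Ico hI₁.ne, closure_Ico hI₂.ne]
  exact ⟨⟨hR₁, h₁⟩, ⟨hR₂, h₂⟩⟩

end TwoWay

theorem proposition1 (U : ℕ) (hU : 1 ≤ U) (u₀ : ℕ) (hu₀ : u₀ ≤ U)
    (p₁ p₂ : ℕ → ℝ) (hp₁ : p₁ 0 = 0) (hp₂ : p₂ 0 = 0)
    (hp₁' : ∀ u ∈ Finset.Icc 1 U, 0 < p₁ u ∧ p₁ u < 1)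
    (hp₂' : ∀ u ∈ Finset.Icc 1 U, 0 < p₂ u ∧ p₂ u < 1)
    (π : ℕ → ℝ) (hπ : TwoWay.IsStationary U p₁ p₂ π)
    (R₁ R₂ : ℝ) (hR₁ : 0 ≤ R₁) (hR₂ : 0 ≤ R₂)
    (h₁ : R₁ ≤ ∑ u ∈ Finset.Icc 1 U, π u * TwoWay.bernEntropy (p₁ u))
    (h₂ : R₂ ≤ ∑ u ∈ Finset.Icc 1 U, π (U - u) * TwoWay.bernEntropy (p₂ u)) :
    (R₁, R₂) ∈ TwoWay.capacityRegion U u₀ := by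
  have hpos := hπ.pos hp₁ hp₂ hp₁' hp₂'
  have hlog : 0 < Real.log 2 := Real.log_pos one_lt_two
  have hne : (Finset.Icc 1 U).Nonempty := Finset.nonempty_Icc.2 hU
  have hI₁ : 0 < ∑ u ∈ Finset.Icc 1 U, π u * TwoWay.bernEntropy (p₁ u) :=
    Finset.sum_pos (fun u hu => mul_pos (hpos u (Finset.mem_Icc.1 hu).2)
      (div_pos (Real.binEntropy_pos (hp₁' u hu).1 (hp₁' u hu).2) hlog)) hne
  have hI₂ : 0 < ∑ u ∈ Finset.Icc 1 U, π (U - u) * TwoWay.bernEntropy (p₂ u) :=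
    Finset.sum_pos (fun u hu => mul_pos (hpos _ (Nat.sub_le U u))
      (div_pos (Real.binEntropy_pos (hp₂' u hu).1 (hp₂' u hu).2) hlog)) hne
  -- a node without energy sends no information, so state `0` may be added to each sum
  have hzero : ∀ f : ℕ → ℝ, f 0 = 0 →
      ∑ u ∈ Finset.Icc 1 U, f u = ∑ u ∈ Finset.Icc 0 U, f u := by
    intro f hf
    refine Finset.sum_subset (Finset.Icc_subset_Icc_left zero_le_one) fun u hu hu' => ?_
    have : u = 0 := by
      simp only [Finset.mem_Icc] at hu hu'
      omega
    rw [this, hf]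
  have e₁ : (∑ u ∈ Finset.Icc 1 U, π u * TwoWay.bernEntropy (p₁ u)) * Real.log 2
      = ∑ u ∈ Finset.Icc 0 U, π u * Real.binEntropy (p₁ u) := by
    rw [← hzero _ (by simp [hp₁]), Finset.sum_mul]
    refine Finset.sum_congr rfl fun u _ => ?_
    rw [TwoWay.bernEntropy, mul_assoc, div_mul_cancel₀ _ hlog.ne']
  have e₂ : (∑ u ∈ Finset.Icc 1 U, π (U - u) * TwoWay.bernEntropy (p₂ u)) * Real.log 2
      = ∑ u ∈ Finset.Icc 0 U, π u * Real.binEntropy (p₂ (U - u)) := by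
    have hrange : Finset.Icc 0 U = Finset.range (U + 1) := by
      ext u; simp
    rw [hrange, ← Finset.sum_range_reflect, ← hrange, hzero _ (by simp [TwoWay.bernEntropy, hp₂]),
      Finset.sum_mul]
    refine Finset.sum_congr rfl fun u hu => ?_
    have hu := (Finset.mem_Icc.1 hu).2
    have h' : U + 1 - 1 - u = U - u := by omega
    rw [h', Nat.sub_sub_self hu, TwoWay.bernEntropy, mul_assoc, div_mul_cancel₀ _ hlog.ne']
  refine TwoWay.mem_closure_of_forall_lt hI₁ hI₂ hR₁ hR₂ h₁ h₂ fun r₁ r₂ hr₁ hr₂ hlt₁ hlt₂ => ?_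
  refine TwoWay.achievable_of_lt hu₀ hp₁ hp₂ hp₁' hp₂' hπ hr₁ hr₂ ?_ ?_
  · rw [← e₁]
    exact mul_lt_mul_of_pos_right hlt₁ hlog
  · rw [← e₂]
    exact mul_lt_mul_of_pos_right hlt₂ hlog
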